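/- **Theorem 4.2.** Let $\tau_0\in\mathbb R$ and let $\Phi=\{\Phi_k\}_{k=0,1,2,\dots}$ be real polynomials with $\deg\Phi_k=k$ and $\Phi_k(\tau_0)=1$; write $\Phi_k(t)=p_{k0}+p_{k1}t+\dots+p_{kk}t^k$. Let $a\le b$ be real numbers. *Linear programming bound.* For a natural number $N$ put $$LP_N(\Phi,[a,b])=1+\inf\Big\{f_1+\dots+f_N:\ f_k\ge 0,\ \sum_{k=1}^N f_k\Phi_k(t)\le -1\ \text{ for all } t\in[a,b]\Big\}$$ (with $\inf\emptyset=+\infty$), and let Delsarte's linear programming bound be $LP(\Phi,[a,b])=\inf_N LP_N(\Phi,[a,b])$. *Semidefinite bound.* For $m\ge 1$ and $x=(x_1,\dots,x_{2m-1})\in\mathbb R^{2m-1}$ put $x_0=1$ and let $\bar H_m(x,[a,b])$ be the block diagonal matrix with the three $m\times m$ diagonal blocks $$(x_{i+j})_{0\le i,j<m},\qquad (x_{i+j+1}-a\,x_{i+j})_{0\le i,j<m},\qquad (b\,x_{i+j}-x_{i+j+1})_{0\le i,j<m}.$$ Let $y^*(m)$ be the infimum of the real numbers $y$ for which there is $x\in\mathbb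 R^{2m-1}$ with $$y+\sum_{i=1}^k p_{ki}x_i\ge -p_{k0}\quad (k=1,\dots,2m-1),\qquad \bar H_m(x,[a,b])\succeq 0.$$ Put $SDP_0(\Phi,[a,b],m)=\dfrac{1+y^*(m)}{y^*(m)}$ if $y^*(m)>0$, and $SDP_0(\Phi,[a,b],m)=+\infty$ otherwise, and let $SDP_0(\Phi,[a,b])=\inf_{m\ge1}SDP_0(\Phi,[a,b],m)$. Then $$SDP_0(\Phi,[a,b])=LP(\Phi,[a,b]).$$ Moreover, $SDP_0(\Phi,[a,b],m)=LP_{2m-1}(\Phi,[a,b])$ for every $m\ge1$. -/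

import Mathlib

open Polynomial

noncomputable section

namespace DelsarteSDP

/-- The `m × m` Hankel matrix `R_m = (s_{i+j})`, rows and columns numbered from `0`. -/
def hankelR (m : ℕ) (s : ℕ → ℝ) : Matrix (Fin m) (Fin m) ℝ :=
  Matrix.of fun i j => s (i + j)

/-- The matrix `F_m^+(a) = (s_{i+j+1} - a s_{i+j})`. -/
def hankelFplus (m : ℕ) (s : ℕ → ℝ) (a : ℝ) : Matrix (Fin m) (Fin m) ℝ :=
  Matrix.of fun i j => s (i + j + 1) - a * s (i + j)

/-- The matrix `F_m^-(b) = (b s_{i+j} - s_{i+j+1})`. -/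
def hankelFminus (m : ℕ) (s : ℕ → ℝ) (b : ℝ) : Matrix (Fin m) (Fin m) ℝ :=
  Matrix.of fun i j => b * s (i + j) - s (i + j + 1)

/-- The block diagonal matrix `H_m(s_0, …, s_{2m-1}, [a,b])` with diagonal blocks
`R_m`, `F_m^+(a)`, `F_m^-(b)`. Only the entries `s_0, …, s_{2m-1}` of `s` occur in it. -/
def hankelH (m : ℕ) (s : ℕ → ℝ) (a b : ℝ) :
    Matrix (Fin m ⊕ (Fin m ⊕ Fin m)) (Fin m ⊕ (Fin m ⊕ Fin m)) ℝ :=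
  Matrix.fromBlocks (hankelR m s) 0 0
    (Matrix.fromBlocks (hankelFplus m s a) 0 0 (hankelFminus m s b))

/-- The sequence `1, x_1, …, x_n` (followed by zeros, which are never used below);
`x_i` is stored as `x ⟨i - 1, _⟩`. -/
def powerSumSeq {n : ℕ} (x : Fin n → ℝ) : ℕ → ℝ
  | 0 => 1
  | k + 1 => if h : k < n then x ⟨k, h⟩ else 0

/-- The normalized matrix
`H̄_m(x_1, …, x_{2m-1}, [a,b]) = H_m(1, x_1, …, x_{2m-1}, [a,b])`. -/
def hankelHbar (m : ℕ) (x : Fin (2 * m - 1) → ℝ) (a b : ℝ) :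
    Matrix (Fin m ⊕ (Fin m ⊕ Fin m)) (Fin m ⊕ (Fin m ⊕ Fin m)) ℝ :=
  hankelH m (powerSumSeq x) a b

/-- `(y, x_1, …, x_{2m-1})` is a feasible point of the semidefinite program with parameter `m`. -/
structure SDP0Feasible (Φ : ℕ → ℝ[X]) (a b : ℝ) (m : ℕ) (y : ℝ) (x : Fin (2 * m - 1) → ℝ) :
    Prop where
  linear : ∀ k ∈ Finset.Icc 1 (2 * m - 1),
    y + ∑ i ∈ Finset.Icc 1 k, (Φ k).coeff i * powerSumSeq x i ≥ -(Φ k).coeff 0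
  psd : (hankelHbar m x a b).PosSemidef

/-- The optimal value `y*(m)` of the semidefinite program with parameter `m`. -/
def sdp0Value (Φ : ℕ → ℝ[X]) (a b : ℝ) (m : ℕ) : EReal :=
  ⨅ (y : ℝ) (_ : ∃ x : Fin (2 * m - 1) → ℝ, SDP0Feasible Φ a b m y x), (y : EReal)

open Classical in
/-- The bound given by the semidefinite program with parameter `m`, namely `(1 + y*) / y*`.
A code with more than one point gives a feasible point with `y = 1 / (|C| - 1) > 0`, so the
inequality `y ≥ y*` bounds `|C|` only if `y* > 0`; otherwise the bound is `+∞`. -/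
def sdp0BoundAt (Φ : ℕ → ℝ[X]) (a b : ℝ) (m : ℕ) : EReal :=
  if 0 < sdp0Value Φ a b m then (1 + sdp0Value Φ a b m) / sdp0Value Φ a b m else ⊤

/-- The bound `SDP₀(Φ, [a,b])`: the best of the bounds over all natural numbers `m ≥ 1`. -/
def sdp0Bound (Φ : ℕ → ℝ[X]) (a b : ℝ) : EReal :=
  ⨅ (m : ℕ) (_ : 1 ≤ m), sdp0BoundAt Φ a b m

/-- `f_1, …, f_N` is a feasible point of the (dual) Delsarte linear program on `[a,b]`;
`f_k` is stored as `f ⟨k - 1, _⟩`. -/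
structure LPFeasible (Φ : ℕ → ℝ[X]) (a b : ℝ) (N : ℕ) (f : Fin N → ℝ) : Prop where
  nonneg : ∀ k, 0 ≤ f k
  le_neg_one : ∀ t ∈ Set.Icc a b, ∑ k : Fin N, f k * (Φ (k + 1)).eval t ≤ -1

/-- The linear programming bound with the number `N` fixed: one plus the infimum of
`f_1 + … + f_N` (`+∞` if there is no feasible point). -/
def lpBoundAt (Φ : ℕ → ℝ[X]) (a b : ℝ) (N : ℕ) : EReal :=
  1 + ⨅ (f : Fin N → ℝ) (_ : LPFeasible Φ a b N f), ((∑ k, f k : ℝ) : EReal)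

/-- Delsarte's linear programming bound `LP(Φ, [a,b]) = 1 + A*`, where `A*` is the infimum of
`f_1 + … + f_N` over all `N` and all feasible `f_1, …, f_N`. -/
def lpBound (Φ : ℕ → ℝ[X]) (a b : ℝ) : EReal :=
  1 + ⨅ (N : ℕ) (f : Fin N → ℝ) (_ : LPFeasible Φ a b N f), ((∑ k, f k : ℝ) : EReal)

end DelsarteSDP

end

/-!
Substituting `L (X ^ i) = x i` turns a feasible point of the semidefinite program into a linear
functional `L` with `L 1 = 1` that is nonnegative on `q ^ 2`, `(X - a) q ^ 2` and `(b - X) q ^ 2`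
for `deg q < m`; the linear constraints become `-y ≤ L (Φ k)`. By the Markov–Lukács theorem such an
`L` is nonnegative on every polynomial of degree less than `2 m` that is nonnegative on `[a, b]`,
so applying it to `-1 - ∑ k, f k • Φ k` gives weak duality `1 ≤ y * ∑ k, f k`. Conversely, if
`0 < c ≤ y*` then every admissible `L` has `L (Φ k) ≤ -c` for some `k`; separating the convex set of
vectors `(L (Φ k))_k` from an orthant gives weights `w` on the simplex with
`∑ k, w k * L (Φ k) ≤ -c`, and `w / c` is feasible for the linear program. Hence the two optimal
values are reciprocal.
-/

namespace DelsarteSDP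

section MarkovLukacs

theorem eval_nonneg_of_mul_nonneg {a b : ℝ} (hab : a < b) {d h : ℝ[X]} (hd0 : d ≠ 0)
    (hd : ∀ t ∈ Set.Icc a b, 0 ≤ d.eval t) (hdh : ∀ t ∈ Set.Icc a b, 0 ≤ (d * h).eval t) :
    ∀ t ∈ Set.Icc a b, 0 ≤ h.eval t := by
  have off_roots : Set.Ioo a b ∩ {t | d.IsRoot t}ᶜ ⊆ {t | 0 ≤ h.eval t} := by
    rintro t ⟨hIoo, hroot⟩
    have ht := Set.Ioo_subset_Icc_self hIoo
    have hdt : 0 < d.eval t := (hd t ht).lt_of_ne' hroot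
    exact nonneg_of_mul_nonneg_right (by simpa using hdh t ht) hdt
  have dense_off_roots : Dense {t | d.IsRoot t}ᶜ :=
    (finite_setOfPred_isRoot hd0).countable.dense_compl ℝ
  have hclosed : IsClosed {t | 0 ≤ h.eval t} := isClosed_le continuous_const h.continuous
  rw [← closure_Ioo hab.ne]
  exact closure_minimal ((dense_off_roots.open_subset_closure_inter isOpen_Ioo).trans
    (closure_minimal off_roots hclosed)) hclosed

theorem X_sub_C_sq_dvd_of_isLocalMin {p : ℝ[X]} {r : ℝ} (hmin : IsLocalMin (fun t => p.eval t) r)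
    (hr : p.eval r = 0) : (X - C r) ^ 2 ∣ p := by
  rcases eq_or_ne p 0 with rfl | hp
  · exact dvd_zero _
  have hderiv : p.derivative.eval r = 0 := by simpa using hmin.deriv_eq_zero
  exact (le_rootMultiplicity_iff hp).1 ((one_lt_rootMultiplicity_iff_isRoot hp).2 ⟨hr, hderiv⟩)

/-- The cone of real polynomials with a certificate of degree at most `n` for nonnegativity on
`[a, b]`: sums of products `(X - a) ^ i * (b - X) ^ j * q ^ 2` of formal degree at most `n`.
A nonnegative scalar can be absorbed into `q`, so additive closure is enough. -/
noncomputable def markovLukacsCone (a b : ℝ) (n : ℕ) : AddSubmonoid ℝ[X] :=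
  AddSubmonoid.closure
    {p | ∃ (i j : ℕ) (q : ℝ[X]), i + j + 2 * q.natDegree ≤ n ∧
      (X - C a) ^ i * (C b - X) ^ j * q ^ 2 = p}

variable {a b : ℝ} {m n : ℕ}

theorem mul_mem_markovLukacsCone {p q : ℝ[X]} (hp : p ∈ markovLukacsCone a b m)
    (hq : q ∈ markovLukacsCone a b n) : p * q ∈ markovLukacsCone a b (m + n) := by
  have hpq := AddSubmonoid.mul_mem_mul hp hq
  rw [markovLukacsCone, markovLukacsCone, AddSubmonoid.closure_mul_closure] at hpq
  refine AddSubmonoid.closure_mono ?_ hpq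
  rintro _ ⟨_, ⟨i, j, f, hf, rfl⟩, _, ⟨k, l, g, hg, rfl⟩, rfl⟩
  refine ⟨i + k, j + l, f * g, ?_, by ring⟩
  have := natDegree_mul_le (p := f) (q := g)
  lia

theorem C_mem_markovLukacsCone {c : ℝ} (hc : 0 ≤ c) : C c ∈ markovLukacsCone a b n :=
  AddSubmonoid.subset_closure
    ⟨0, 0, C (√c), by simp, by rw [← C_pow, Real.sq_sqrt hc]; simp⟩

theorem X_sub_C_mem_markovLukacsCone : X - C a ∈ markovLukacsCone a b 1 :=
  AddSubmonoid.subset_closure ⟨1, 0, 1, by simp, by simp⟩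

theorem C_sub_X_mem_markovLukacsCone : C b - X ∈ markovLukacsCone a b 1 :=
  AddSubmonoid.subset_closure ⟨0, 1, 1, by simp, by simp⟩

theorem X_sub_C_sq_mem_markovLukacsCone (r : ℝ) : (X - C r) ^ 2 ∈ markovLukacsCone a b 2 :=
  AddSubmonoid.subset_closure ⟨0, 0, X - C r, by simp, by simp⟩

theorem eval_nonneg_of_mem_markovLukacsCone {p : ℝ[X]} (hp : p ∈ markovLukacsCone a b n)
    {t : ℝ} (ht : t ∈ Set.Icc a b) : 0 ≤ p.eval t := by
  induction hp using AddSubmonoid.closure_induction with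
  | mem p hp =>
    obtain ⟨i, j, q, -, rfl⟩ := hp
    have hat := sub_nonneg.2 ht.1
    have htb := sub_nonneg.2 ht.2
    simp only [eval_mul, eval_pow, eval_sub, eval_X, eval_C]
    positivity
  | zero => simp
  | add p q _ _ hp hq => simpa using add_nonneg hp hq

theorem exists_dvd_mem_markovLukacsCone {p : ℝ[X]} (hp : ∀ t ∈ Set.Icc a b, 0 ≤ p.eval t)
    {r : ℝ} (hr : r ∈ Set.Icc a b) (hroot : p.eval r = 0) :
    ∃ d ∈ markovLukacsCone a b d.natDegree, 0 < d.natDegree ∧ d ∣ p := by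
  have hdvd : X - C r ∣ p := dvd_iff_isRoot.2 hroot
  rcases hr.1.eq_or_lt with rfl | har
  · exact ⟨X - C a, by simpa using X_sub_C_mem_markovLukacsCone, by simp, hdvd⟩
  rcases hr.2.eq_or_lt with rfl | hrb
  · have hneg : C r - X = -(X - C r) := (neg_sub _ _).symm
    have hdeg : (C r - X).natDegree = 1 := by rw [hneg, natDegree_neg, natDegree_X_sub_C]
    exact ⟨C r - X, hdeg ▸ C_sub_X_mem_markovLukacsCone, by simp [hdeg], hneg ▸ neg_dvd.2 hdvd⟩
  · have hmin : IsLocalMin (fun t => p.eval t) r := by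
      filter_upwards [Icc_mem_nhds har hrb] with t ht
      exact hroot.trans_le (hp t ht)
    exact ⟨(X - C r) ^ 2, by simpa using X_sub_C_sq_mem_markovLukacsCone r, by simp,
      X_sub_C_sq_dvd_of_isLocalMin hmin hroot⟩

-- Subtract the minimum, split off the factor vanishing there, and induct on the degree.
theorem mem_markovLukacsCone_of_nonneg (hab : a < b) {p : ℝ[X]} (hdeg : p.natDegree ≤ n)
    (hp : ∀ t ∈ Set.Icc a b, 0 ≤ p.eval t) : p ∈ markovLukacsCone a b n := by
  induction n using Nat.strong_induction_on generalizing p with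
  | _ n ih =>
  obtain ⟨r, hr, hmin⟩ := isCompact_Icc.exists_isMinOn (Set.nonempty_Icc.2 hab.le)
    p.continuous.continuousOn
  set g := p - C (p.eval r) with hg
  suffices g ∈ markovLukacsCone a b n by
    simpa [hg] using add_mem this (C_mem_markovLukacsCone (hp r hr))
  rcases eq_or_ne g 0 with hg0 | hg0
  · exact hg0 ▸ zero_mem _
  have hgnonneg : ∀ t ∈ Set.Icc a b, 0 ≤ g.eval t := fun t ht => by
    simpa [hg] using hmin ht
  obtain ⟨d, hd, hdpos, h, hgh⟩ := exists_dvd_mem_markovLukacsCone hgnonneg hr (by simp [hg])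
  have hdh : d * h ≠ 0 := hgh ▸ hg0
  have hgdeg : d.natDegree + h.natDegree ≤ n := by
    rw [← natDegree_mul (left_ne_zero_of_mul hdh) (right_ne_zero_of_mul hdh), ← hgh, hg,
      natDegree_sub_C]
    exact hdeg
  have hh : h ∈ markovLukacsCone a b (n - d.natDegree) :=
    ih _ (by lia) (by lia) (eval_nonneg_of_mul_nonneg hab (left_ne_zero_of_mul hdh)
      (fun t ht => eval_nonneg_of_mem_markovLukacsCone hd ht) (hgh ▸ hgnonneg))
  rw [hgh, ← Nat.add_sub_of_le (show d.natDegree ≤ n by lia)]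
  exact mul_mem_markovLukacsCone hd hh

end MarkovLukacs

section PseudoExpectation

/-- The pseudo-expectations of order `m` on `[a, b]`, i.e. normalized linear functionals on
polynomials that look, on polynomials of degree less than `2 * m`, like integration against a
probability measure on `[a, b]`. Values on higher degrees are unconstrained. -/
def pseudoExpectations (a b : ℝ) (m : ℕ) : Set (ℝ[X] →ₗ[ℝ] ℝ) :=
  {L | L 1 = 1 ∧ ∀ q ∈ degreeLT ℝ m,
    0 ≤ L (q ^ 2) ∧ 0 ≤ L ((X - C a) * q ^ 2) ∧ 0 ≤ L ((C b - X) * q ^ 2)}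

variable {a b : ℝ} {m : ℕ} {L : ℝ[X] →ₗ[ℝ] ℝ}

theorem leval_mem_pseudoExpectations {t : ℝ} (ht : t ∈ Set.Icc a b) :
    leval t ∈ pseudoExpectations a b m := by
  have hat := sub_nonneg.2 ht.1
  have htb := sub_nonneg.2 ht.2
  refine ⟨by simp [leval_apply], fun q _ => ?_⟩
  simp only [leval_apply, eval_mul, eval_pow, eval_sub, eval_X, eval_C]
  exact ⟨by positivity, by positivity, by positivity⟩

theorem convex_pseudoExpectations : Convex ℝ (pseudoExpectations a b m) := by
  rintro L ⟨hL1, hL⟩ M ⟨hM1, hM⟩ α β hα hβ hαβ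
  refine ⟨by simp [hL1, hM1, hαβ], fun q hq => ?_⟩
  obtain ⟨hL₀, hLa, hLb⟩ := hL q hq
  obtain ⟨hM₀, hMa, hMb⟩ := hM q hq
  simp only [LinearMap.add_apply, LinearMap.smul_apply, smul_eq_mul]
  exact ⟨by positivity, by positivity, by positivity⟩

theorem pseudoExpectations_mono_right {b' : ℝ} (hb : b ≤ b') :
    pseudoExpectations a b m ⊆ pseudoExpectations a b' m := by
  rintro L ⟨hL1, hL⟩
  refine ⟨hL1, fun q hq => ⟨(hL q hq).1, (hL q hq).2.1, ?_⟩⟩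
  have hsplit : (C b' - X) * q ^ 2 = (C b - X) * q ^ 2 + (b' - b) • q ^ 2 := by
    rw [smul_eq_C_mul, C_sub]
    ring
  rw [hsplit, map_add, map_smul]
  exact add_nonneg (hL q hq).2.2 (mul_nonneg (sub_nonneg.2 hb) (hL q hq).1)

theorem map_generator_nonneg (hab : a < b) (hL : L ∈ pseudoExpectations a b m) (i j : ℕ)
    (q : ℝ[X]) (hdeg : i + j + 2 * q.natDegree < 2 * m) :
    0 ≤ L ((X - C a) ^ i * (C b - X) ^ j * q ^ 2) := by
  have hpos : ∀ k l : ℕ, k + l + q.natDegree < m →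
      let f := (X - C a) ^ k * (C b - X) ^ l * q
      0 ≤ L (f ^ 2) ∧ 0 ≤ L ((X - C a) * f ^ 2) ∧ 0 ≤ L ((C b - X) * f ^ 2) := by
    refine fun k l hkl => hL.2 _ (mem_degreeLT.2 (degree_le_natDegree.trans_lt ?_))
    refine WithBot.coe_lt_coe.2 (lt_of_le_of_lt ?_ hkl)
    have hk : ((X - C a) ^ k).natDegree ≤ k := by compute_degree
    have hl : ((C b - X) ^ l).natDegree ≤ l := by compute_degree
    exact natDegree_mul_le_of_le (natDegree_mul_le_of_le hk hl) le_rfl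
  rcases i.even_or_odd' with ⟨k, rfl | rfl⟩ <;> rcases j.even_or_odd' with ⟨l, rfl | rfl⟩
  · convert (hpos k l (by lia)).1 using 2
    ring
  · convert (hpos k l (by lia)).2.2 using 2
    ring
  · convert (hpos k l (by lia)).2.1 using 2
    ring
  · -- `(b - a) (X - a) (b - X) = (b - X) (X - a)² + (X - a) (b - X)²`
    refine nonneg_of_mul_nonneg_right ?_ (sub_pos.2 hab)
    rw [← smul_eq_mul, ← map_smul, smul_eq_C_mul, C_sub]
    convert add_nonneg (hpos (k + 1) l (by lia)).2.2 (hpos k (l + 1) (by lia)).2.1 using 1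
    rw [← map_add]
    congr 1
    ring

theorem map_nonneg_of_mem_markovLukacsCone (hab : a < b) (hL : L ∈ pseudoExpectations a b m)
    {n : ℕ} (hn : n < 2 * m) {p : ℝ[X]} (hp : p ∈ markovLukacsCone a b n) : 0 ≤ L p := by
  induction hp using AddSubmonoid.closure_induction with
  | mem p hp =>
    obtain ⟨i, j, q, hdeg, rfl⟩ := hp
    exact map_generator_nonneg hab hL i j q (hdeg.trans_lt hn)
  | zero => simp
  | add p q _ _ hp hq => simpa using add_nonneg hp hq

theorem map_nonneg_of_eval_nonneg (hab : a ≤ b) (hL : L ∈ pseudoExpectations a b m) {p : ℝ[X]}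
    (hdeg : p.natDegree < 2 * m) (hp : ∀ t ∈ Set.Icc a b, 0 ≤ p.eval t) : 0 ≤ L p := by
  rcases hab.eq_or_lt with rfl | hab
  · -- `L` is a pseudo-expectation on every `[a, b]`, and `p + ε` is nonnegative on a small one.
    refine le_of_forall_pos_le_add fun ε hε => ?_
    have hnear : ∀ᶠ t in nhdsWithin a (Set.Ici a), -ε < p.eval t :=
      p.continuous.continuousWithinAt.eventually_const_lt
        (by linarith [hp a (Set.left_mem_Icc.2 le_rfl)])
    obtain ⟨b, hb, hsub⟩ := mem_nhdsGE_iff_exists_Icc_subset.1 hnear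
    have hcone : p + C ε ∈ markovLukacsCone a b p.natDegree :=
      mem_markovLukacsCone_of_nonneg hb (by simp) fun t ht => by
        have : -ε < p.eval t := hsub ht
        simp only [eval_add, eval_C]
        linarith
    have hnonneg := map_nonneg_of_mem_markovLukacsCone hb
      (pseudoExpectations_mono_right (le_of_lt hb) hL) hdeg hcone
    rwa [map_add, ← mul_one (C ε), ← smul_eq_C_mul, map_smul, hL.1, smul_eq_mul, mul_one]
      at hnonneg
  · exact map_nonneg_of_mem_markovLukacsCone hab hL hdeg
      (mem_markovLukacsCone_of_nonneg hab le_rfl hp)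

end PseudoExpectation
section Hankel

theorem posSemidef_fromBlocks_zero_iff {R ι κ : Type*} [Ring R] [PartialOrder R] [StarRing R]
    [IsOrderedAddMonoid R] [Finite ι] [Finite κ] {A : Matrix ι ι R} {D : Matrix κ κ R} :
    (Matrix.fromBlocks A 0 0 D).PosSemidef ↔ A.PosSemidef ∧ D.PosSemidef := by
  refine ⟨fun h => ⟨h.submatrix Sum.inl, h.submatrix Sum.inr⟩, fun ⟨hA, hD⟩ => ?_⟩
  have := Fintype.ofFinite ι
  have := Fintype.ofFinite κ
  refine .of_dotProduct_mulVec_nonneg (hA.1.fromBlocks (by simp) hD.1) fun v => ?_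
  rw [Matrix.fromBlocks_mulVec]
  simpa [dotProduct] using add_nonneg
    (hA.dotProduct_mulVec_nonneg (v ∘ Sum.inl)) (hD.dotProduct_mulVec_nonneg (v ∘ Sum.inr))

/-- The localizing matrix of order `m` of the functional `L` at the weight `w`, which represents
the quadratic form `q ↦ L (w * q ^ 2)` on polynomials of degree less than `m` in the monomial
basis. The three diagonal blocks of `hankelH` have this form. -/
noncomputable def localizingMatrix (L : ℝ[X] →ₗ[ℝ] ℝ) (w : ℝ[X]) (m : ℕ) :
    Matrix (Fin m) (Fin m) ℝ :=
  Matrix.of fun i j => L (w * X ^ ((i : ℕ) + j))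

theorem dotProduct_localizingMatrix_mulVec (L : ℝ[X] →ₗ[ℝ] ℝ) (w : ℝ[X]) {m : ℕ}
    (v : Fin m → ℝ) :
    v ⬝ᵥ (localizingMatrix L w m).mulVec v = L (w * (∑ i : Fin m, monomial i (v i)) ^ 2) := by
  rw [sq, Finset.sum_mul_sum]
  simp only [dotProduct, Matrix.mulVec, localizingMatrix, Matrix.of_apply, Finset.mul_sum, map_sum]
  refine Finset.sum_congr rfl fun i _ => Finset.sum_congr rfl fun j _ => ?_
  rw [monomial_mul_monomial, ← C_mul_X_pow_eq_monomial, mul_left_comm w, ← smul_eq_C_mul,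
    map_smul, smul_eq_mul]
  ring

theorem posSemidef_localizingMatrix_iff {L : ℝ[X] →ₗ[ℝ] ℝ} {w : ℝ[X]} {m : ℕ} :
    (localizingMatrix L w m).PosSemidef ↔ ∀ q ∈ degreeLT ℝ m, 0 ≤ L (w * q ^ 2) := by
  have hherm : (localizingMatrix L w m).IsHermitian := by
    ext i j
    simp [localizingMatrix, add_comm]
  simp only [Matrix.posSemidef_iff_dotProduct_mulVec, hherm, true_and, star_trivial,
    dotProduct_localizingMatrix_mulVec]
  refine ⟨fun h q hq => ?_, fun h v => h _ ((degreeLTEquiv ℝ m).symm v).2⟩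
  have hsum : ∑ i : Fin m, monomial i (q.coeff i) = q :=
    congrArg Subtype.val ((degreeLTEquiv ℝ m).symm_apply_apply ⟨q, hq⟩)
  simpa only [hsum] using h fun i => q.coeff i

variable {a b : ℝ} {m : ℕ} {L : ℝ[X] →ₗ[ℝ] ℝ}

theorem posSemidef_hankelH_iff {s : ℕ → ℝ} (hs : ∀ k < 2 * m, L (X ^ k) = s k) :
    (hankelH m s a b).PosSemidef ↔ ∀ q ∈ degreeLT ℝ m,
      0 ≤ L (q ^ 2) ∧ 0 ≤ L ((X - C a) * q ^ 2) ∧ 0 ≤ L ((C b - X) * q ^ 2) := by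
  have hR : hankelR m s = localizingMatrix L 1 m := by
    ext i j
    simp [hankelR, localizingMatrix, hs (i + j) (by lia)]
  have hplus : hankelFplus m s a = localizingMatrix L (X - C a) m := by
    ext i j
    simp [hankelFplus, localizingMatrix, sub_mul, ← pow_succ', ← smul_eq_C_mul,
      hs (i + j) (by lia), hs (i + j + 1) (by lia)]
  have hminus : hankelFminus m s b = localizingMatrix L (C b - X) m := by
    ext i j
    simp [hankelFminus, localizingMatrix, sub_mul, ← pow_succ', ← smul_eq_C_mul,
      hs (i + j) (by lia), hs (i + j + 1) (by lia)]
  rw [hankelH, posSemidef_fromBlocks_zero_iff, posSemidef_fromBlocks_zero_iff, hR, hplus, hminus]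
  simp only [posSemidef_localizingMatrix_iff, one_mul, forall_and]

theorem map_eq_sum_coeff_mul (L : ℝ[X] →ₗ[ℝ] ℝ) {p : ℝ[X]} {n : ℕ} (hp : p.natDegree ≤ n) :
    L p = p.coeff 0 * L 1 + ∑ i ∈ Finset.Icc 1 n, p.coeff i * L (X ^ i) := by
  have hsum : L p = ∑ i ∈ Finset.range (n + 1), p.coeff i * L (X ^ i) := by
    conv_lhs => rw [p.as_sum_range_C_mul_X_pow' (Nat.lt_succ_of_le hp)]
    simp only [map_sum, ← smul_eq_C_mul, map_smul, smul_eq_mul]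
  rw [hsum, Finset.range_eq_Ico, Finset.sum_eq_sum_Ico_succ_bot n.succ_pos, pow_zero]
  rfl

theorem sdp0Feasible_iff {Φ : ℕ → ℝ[X]} (hdeg : ∀ k, (Φ k).natDegree ≤ k) {y : ℝ}
    {x : Fin (2 * m - 1) → ℝ} (hx : ∀ k ≤ 2 * m - 1, L (X ^ k) = powerSumSeq x k) :
    SDP0Feasible Φ a b m y x ↔
      L ∈ pseudoExpectations a b m ∧ ∀ k ∈ Finset.Icc 1 (2 * m - 1), -y ≤ L (Φ k) := by
  have hL1 : L 1 = 1 := by simpa [powerSumSeq] using hx 0 (Nat.zero_le _)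
  have hpsd : (hankelHbar m x a b).PosSemidef ↔ L ∈ pseudoExpectations a b m := by
    rw [hankelHbar, posSemidef_hankelH_iff fun k hk => hx k (by lia)]
    simp [pseudoExpectations, hL1]
  have hlin : ∀ k ∈ Finset.Icc 1 (2 * m - 1),
      L (Φ k) = (Φ k).coeff 0 + ∑ i ∈ Finset.Icc 1 k, (Φ k).coeff i * powerSumSeq x i := by
    intro k hk
    rw [map_eq_sum_coeff_mul L (hdeg k), hL1, mul_one]
    congr 1
    refine Finset.sum_congr rfl fun i hi => ?_
    rw [hx i ((Finset.mem_Icc.1 hi).2.trans (Finset.mem_Icc.1 hk).2)]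
  constructor
  · rintro ⟨hy, hH⟩
    exact ⟨hpsd.1 hH, fun k hk => by linarith [hy k hk, hlin k hk]⟩
  · rintro ⟨hL, hy⟩
    exact ⟨fun k hk => by linarith [hy k hk, hlin k hk], hpsd.2 hL⟩

theorem exists_sdp0Feasible_iff {Φ : ℕ → ℝ[X]} (hdeg : ∀ k, (Φ k).natDegree ≤ k) {y : ℝ} :
    (∃ x, SDP0Feasible Φ a b m y x) ↔
      ∃ L ∈ pseudoExpectations a b m, ∀ k : Fin (2 * m - 1), -y ≤ L (Φ (k + 1)) := by
  have hindex : ∀ L : ℝ[X] →ₗ[ℝ] ℝ, (∀ k ∈ Finset.Icc 1 (2 * m - 1), -y ≤ L (Φ k)) ↔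
      ∀ k : Fin (2 * m - 1), -y ≤ L (Φ (k + 1)) := fun L =>
    ⟨fun h k => h _ (Finset.mem_Icc.2 ⟨by lia, k.2⟩), fun h k hk => by
      obtain ⟨hk₁, hk₂⟩ := Finset.mem_Icc.1 hk
      simpa [Nat.sub_add_cancel hk₁] using h ⟨k - 1, by lia⟩⟩
  simp only [← hindex]
  constructor
  · rintro ⟨x, hx⟩
    have hmoments : ∀ k, (basisMonomials ℝ).constr ℝ (powerSumSeq x) (X ^ k) =
        powerSumSeq x k := fun k => by
      rw [X_pow_eq_monomial]
      exact (basisMonomials ℝ).constr_basis ℝ _ k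
    exact ⟨_, (sdp0Feasible_iff hdeg fun k _ => hmoments k).1 hx⟩
  · rintro ⟨L, hL⟩
    refine ⟨fun i => L (X ^ ((i : ℕ) + 1)), (sdp0Feasible_iff hdeg fun k hk => ?_).2 hL⟩
    cases k with
    | zero => simpa [powerSumSeq] using hL.1.1
    | succ k => simp [powerSumSeq, show k < 2 * m - 1 by lia]

end Hankel

section Duality

theorem map_eq_sum_mul_map_single {ι : Type*} [Fintype ι] [DecidableEq ι]
    (F : (ι → ℝ) →ₗ[ℝ] ℝ) (z : ι → ℝ) : F z = ∑ k, F (Pi.single k 1) * z k := by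
  conv_lhs => rw [pi_eq_sum_univ' z]
  simp [mul_comm]

theorem map_single_nonpos_of_le_on_orthant {ι : Type*} [DecidableEq ι] {F : (ι → ℝ) →ₗ[ℝ] ℝ}
    {c u : ℝ} (hF : ∀ z, (∀ k, c ≤ z k) → F z ≤ u) (k : ι) : F (Pi.single k 1) ≤ 0 := by
  by_contra! hpos
  obtain ⟨n, hn⟩ := Archimedean.arch (u - F (fun _ => c) + 1) hpos
  have hsingle : (0 : ι → ℝ) ≤ Pi.single k 1 := Pi.single_nonneg.2 zero_le_one
  have hray := hF ((fun _ => c) + n • Pi.single k 1) fun i =>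
    le_add_of_nonneg_right (nsmul_nonneg (hsingle i) n)
  rw [map_add, map_nsmul] at hray
  linarith

-- Separate the convex set from the open orthant of the `z` with `c < z k` for all `k`.
theorem exists_mem_stdSimplex_forall_sum_le {ι : Type*} [Fintype ι] {K : Set (ι → ℝ)}
    (hK : Convex ℝ K) (hne : K.Nonempty) {c : ℝ} (hc : ∀ z ∈ K, ∃ k, z k ≤ c) :
    ∃ w ∈ stdSimplex ℝ ι, ∀ z ∈ K, ∑ k, w k * z k ≤ c := by
  classical
  set Q : Set (ι → ℝ) := Set.univ.pi fun _ => Set.Ioi c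
  have hdisj : Disjoint Q K := Set.disjoint_left.2 fun z hzQ hzK => by
    obtain ⟨k, hk⟩ := hc z hzK
    exact hk.not_gt (hzQ k trivial)
  obtain ⟨F, u, hFQ, hFK⟩ := geometric_hahn_banach_open (convex_pi fun _ _ => convex_Ioi c)
    (isOpen_set_pi Set.finite_univ fun _ _ => isOpen_Ioi) hK hdisj
  have hFclosure : ∀ z : ι → ℝ, (∀ k, c ≤ z k) → F z ≤ u := fun z hz =>
    closure_minimal (fun v hv => (hFQ v hv).le) (isClosed_le F.continuous continuous_const)
      (by simpa [Q, closure_pi_set, Pi.le_def] using hz)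
  have hF : ∀ z, F z = ∑ k, F (Pi.single k 1) * z k := map_eq_sum_mul_map_single F.toLinearMap
  have hnonpos : ∀ k, F (Pi.single k 1) ≤ 0 :=
    map_single_nonpos_of_le_on_orthant (F := F.toLinearMap) hFclosure
  set S := -∑ k, F (Pi.single k 1) with hS
  have hconst : ∀ r : ℝ, F (fun _ => r) = -(r * S) := fun r => by
    rw [hF, ← Finset.sum_mul, hS]
    ring
  have hcS : -(c * S) ≤ u := hconst c ▸ hFclosure _ fun _ => le_rfl
  have hSpos : 0 < S := by
    refine (neg_nonneg.2 (Finset.sum_nonpos fun k _ => hnonpos k)).lt_of_ne' fun hS0 => ?_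
    have hzero : ∀ k, F (Pi.single k 1) = 0 := fun k =>
      (Finset.sum_eq_zero_iff_of_nonpos fun k _ => hnonpos k).1 (neg_eq_zero.1 hS0) k
        (Finset.mem_univ k)
    obtain ⟨z, hz⟩ := hne
    have hlt : F (fun _ => c + 1) < F z :=
      (hFQ _ fun _ _ => lt_add_one c).trans_le (hFK z hz)
    rw [hF, hF z] at hlt
    simp [hzero] at hlt
  refine ⟨fun k => -F (Pi.single k 1) / S, ⟨fun k => ?_, ?_⟩, fun z hz => ?_⟩
  · exact div_nonneg (neg_nonneg.2 (hnonpos k)) hSpos.le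
  · rw [← Finset.sum_div, Finset.sum_neg_distrib, div_self hSpos.ne']
  · have hsum : ∑ k, -F (Pi.single k 1) / S * z k = -F z / S := by
      rw [hF z, ← Finset.sum_neg_distrib, Finset.sum_div]
      exact Finset.sum_congr rfl fun k _ => by ring
    rw [hsum, div_le_iff₀ hSpos]
    linarith [hFK z hz]

variable {Φ : ℕ → ℝ[X]} {a b : ℝ}

theorem LPFeasible.sum_pos (hab : a ≤ b) {N : ℕ} {f : Fin N → ℝ} (hf : LPFeasible Φ a b N f) :
    0 < ∑ k, f k := by
  refine (Finset.sum_nonneg fun k _ => hf.nonneg k).lt_of_ne' fun h0 => ?_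
  have hzero : f = 0 := (Fintype.sum_eq_zero_iff_of_nonneg hf.nonneg).1 h0
  have := hf.le_neg_one a (Set.left_mem_Icc.2 hab)
  norm_num [hzero] at this

theorem LPFeasible.one_le_mul_sum (hdeg : ∀ k, (Φ k).natDegree ≤ k) (hab : a ≤ b) {m N : ℕ}
    (hN : N < 2 * m) {L : ℝ[X] →ₗ[ℝ] ℝ} (hL : L ∈ pseudoExpectations a b m) {y : ℝ}
    (hy : ∀ k : Fin N, -y ≤ L (Φ (k + 1))) {f : Fin N → ℝ} (hf : LPFeasible Φ a b N f) :
    1 ≤ y * ∑ k, f k := by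
  set p : ℝ[X] := ∑ k, f k • Φ (k + 1)
  have hpdeg : p.natDegree ≤ N := natDegree_sum_le_of_forall_le _ _ fun k _ =>
    (natDegree_smul_le _ _).trans ((hdeg _).trans k.2)
  have hLp : 0 ≤ L (-1 - p) := by
    refine map_nonneg_of_eval_nonneg hab hL ?_ fun t ht => ?_
    · exact (natDegree_sub_le_of_le (by simp) hpdeg).trans_lt (max_lt (N.zero_le.trans_lt hN) hN)
    · have := hf.le_neg_one t ht
      simp only [p, eval_sub, eval_neg, eval_one, eval_finsetSum, eval_smul, smul_eq_mul]
      linarith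
  have hLp' : -y * ∑ k, f k ≤ L p := by
    simp only [p, map_sum, map_smul, smul_eq_mul, Finset.mul_sum]
    exact Finset.sum_le_sum fun k _ => by
      rw [mul_comm]
      exact mul_le_mul_of_nonneg_left (hy k) (hf.nonneg k)
  rw [map_sub, map_neg, hL.1] at hLp
  linarith

theorem exists_lpFeasible_sum_eq_inv {S : Set (ℝ[X] →ₗ[ℝ] ℝ)} (hS : Convex ℝ S)
    (hSne : S.Nonempty) (hev : ∀ t ∈ Set.Icc a b, leval t ∈ S) {N : ℕ} {c : ℝ} (hc : 0 < c)
    (h : ∀ L ∈ S, ∃ k : Fin N, L (Φ (k + 1)) ≤ -c) :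
    ∃ f, LPFeasible Φ a b N f ∧ ∑ k, f k = c⁻¹ := by
  set values : (ℝ[X] →ₗ[ℝ] ℝ) →ₗ[ℝ] (Fin N → ℝ) :=
    LinearMap.pi fun k => LinearMap.applyₗ (Φ (k + 1))
  obtain ⟨w, ⟨hw, hwsum⟩, hle⟩ := exists_mem_stdSimplex_forall_sum_le
    (hS.linear_image values) (hSne.image values) (Set.forall_mem_image.2 h)
  refine ⟨fun k => c⁻¹ * w k,
    ⟨fun k => mul_nonneg (inv_pos.2 hc).le (hw k), fun t ht => ?_⟩, ?_⟩
  · have hwt : ∑ k, w k * (Φ (k + 1)).eval t ≤ -c := hle _ ⟨_, hev t ht, rfl⟩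
    simp only [mul_assoc, ← Finset.mul_sum]
    rw [inv_mul_le_iff₀ hc]
    linarith
  · rw [← Finset.mul_sum, hwsum, mul_one]

theorem coe_le_sdp0Value_iff (hdeg : ∀ k, (Φ k).natDegree ≤ k) (hab : a ≤ b) {m : ℕ} (hm : 1 ≤ m)
    {c : ℝ} (hc : 0 < c) :
    (c : EReal) ≤ sdp0Value Φ a b m ↔
      ∃ f, LPFeasible Φ a b (2 * m - 1) f ∧ ∑ k, f k = c⁻¹ := by
  simp only [sdp0Value, exists_sdp0Feasible_iff hdeg, le_iInf_iff, EReal.coe_le_coe_iff]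
  constructor
  · intro hle
    have hev : ∀ t ∈ Set.Icc a b, leval t ∈ pseudoExpectations a b m :=
      fun t ht => leval_mem_pseudoExpectations ht
    refine exists_lpFeasible_sum_eq_inv convex_pseudoExpectations
      ⟨_, hev a (Set.left_mem_Icc.2 hab)⟩ hev hc fun L hL => ?_
    have : NeZero (2 * m - 1) := ⟨by lia⟩
    obtain ⟨k, hk⟩ := Finite.exists_min fun k : Fin (2 * m - 1) => L (Φ (k + 1))
    exact ⟨k, le_neg_of_le_neg (hle _ ⟨L, hL, fun j => by simpa using hk j⟩)⟩
  · rintro ⟨f, hf, hsum⟩ y ⟨L, hL, hy⟩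
    have := hf.one_le_mul_sum hdeg hab (by lia) hL hy
    rwa [hsum, ← div_eq_mul_inv, one_le_div hc] at this

theorem sdp0Value_lt_top (hdeg : ∀ k, (Φ k).natDegree ≤ k) (hab : a ≤ b) (m : ℕ) :
    sdp0Value Φ a b m < ⊤ := by
  obtain ⟨c, hc⟩ := (Set.finite_range fun k : Fin (2 * m - 1) => (Φ (k + 1)).eval a).bddBelow
  have hfeas : ∃ x, SDP0Feasible Φ a b m (-c) x := (exists_sdp0Feasible_iff hdeg).2
    ⟨leval a, leval_mem_pseudoExpectations (Set.left_mem_Icc.2 hab), fun k => by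
      simpa using hc ⟨k, rfl⟩⟩
  exact (iInf₂_le (-c) hfeas).trans_lt (EReal.coe_lt_top _)

theorem sdp0BoundAt_eq_lpBoundAt (hdeg : ∀ k, (Φ k).natDegree ≤ k) (hab : a ≤ b) {m : ℕ}
    (hm : 1 ≤ m) : sdp0BoundAt Φ a b m = lpBoundAt Φ a b (2 * m - 1) := by
  have hle : ∀ f, LPFeasible Φ a b (2 * m - 1) f →
      (((∑ k, f k)⁻¹ : ℝ) : EReal) ≤ sdp0Value Φ a b m := fun f hf =>
    (coe_le_sdp0Value_iff hdeg hab hm (inv_pos.2 (hf.sum_pos hab))).2 ⟨f, hf, (inv_inv _).symm⟩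
  rw [sdp0BoundAt, lpBoundAt]
  split_ifs with hpos
  · lift sdp0Value Φ a b m to ℝ
      using ⟨(sdp0Value_lt_top hdeg hab m).ne, ne_bot_of_gt hpos⟩ with v hv
    have hv0 : 0 < v := EReal.coe_pos.1 hpos
    obtain ⟨f, hf, hfsum⟩ := (coe_le_sdp0Value_iff hdeg hab hm hv0).1 hv.le
    have hinf : ⨅ (f : Fin (2 * m - 1) → ℝ) (_ : LPFeasible Φ a b (2 * m - 1) f),
        ((∑ k, f k : ℝ) : EReal) = (v⁻¹ : ℝ) := by
      refine le_antisymm ((iInf₂_le f hf).trans_eq (by rw [hfsum])) (le_iInf₂ fun g hg => ?_)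
      exact EReal.coe_le_coe_iff.2
        (inv_le_of_inv_le₀ (hg.sum_pos hab) (EReal.coe_le_coe_iff.1 (hle g hg)))
    rw [hinf, ← EReal.coe_one, ← EReal.coe_add, ← EReal.coe_add, ← EReal.coe_div,
      EReal.coe_eq_coe_iff]
    field_simp
    ring
  · have hempty : ∀ f, ¬ LPFeasible Φ a b (2 * m - 1) f := fun f hf =>
      hpos ((EReal.coe_pos.2 (inv_pos.2 (hf.sum_pos hab))).trans_le (hle f hf))
    simp only [hempty, iInf_false, iInf_top]
    rfl

end Duality

section LPBound

variable {Φ : ℕ → ℝ[X]} {a b : ℝ}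

theorem LPFeasible.snoc_zero {N : ℕ} {f : Fin N → ℝ} (hf : LPFeasible Φ a b N f) :
    LPFeasible Φ a b (N + 1) (Fin.snoc f 0) where
  nonneg := Fin.lastCases (by simp) fun k => by simpa using hf.nonneg k
  le_neg_one t ht := by simpa [Fin.sum_univ_castSucc] using hf.le_neg_one t ht

theorem antitone_lpBoundAt (Φ : ℕ → ℝ[X]) (a b : ℝ) : Antitone (lpBoundAt Φ a b) := by
  refine antitone_nat_of_succ_le fun N => add_le_add_right (le_iInf₂ fun f hf => ?_) 1
  exact (iInf₂_le _ hf.snoc_zero).trans_eq (by simp [Fin.sum_univ_castSucc])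

theorem coe_add_iInf {ι : Sort*} (c : ℝ) (u : ι → EReal) : c + ⨅ i, u i = ⨅ i, (c + u i) :=
  GaloisConnection.u_iInf (l := (· - (c : EReal))) (u := ((c : EReal) + ·)) fun x y => by
    rw [EReal.sub_le_iff_le_add (.inl (EReal.coe_ne_bot c)) (.inl (EReal.coe_ne_top c)), add_comm]

theorem iInf_lpBoundAt_odd (Φ : ℕ → ℝ[X]) (a b : ℝ) :
    ⨅ (m : ℕ) (_ : 1 ≤ m), lpBoundAt Φ a b (2 * m - 1) = lpBound Φ a b := by
  have hall : lpBound Φ a b = ⨅ N, lpBoundAt Φ a b N := by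
    rw [lpBound, ← EReal.coe_one, coe_add_iInf]
    rfl
  rw [hall]
  refine le_antisymm (le_iInf fun N => ?_) (le_iInf₂ fun m _ => iInf_le _ (2 * m - 1))
  exact (iInf₂_le (N + 1) N.succ_pos).trans (antitone_lpBoundAt Φ a b (by lia))

end LPBound

end DelsarteSDP

open DelsarteSDP in
theorem theorem4p2_general (Φ : ℕ → ℝ[X]) (a b : ℝ) (hdeg : ∀ k, (Φ k).natDegree ≤ k)
    (hab : a ≤ b) :
    sdp0Bound Φ a b = lpBound Φ a b ∧
      ∀ m : ℕ, 1 ≤ m → sdp0BoundAt Φ a b m = lpBoundAt Φ a b (2 * m - 1) := by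
  have hat : ∀ m : ℕ, 1 ≤ m → sdp0BoundAt Φ a b m = lpBoundAt Φ a b (2 * m - 1) :=
    fun m hm => sdp0BoundAt_eq_lpBoundAt hdeg hab hm
  refine ⟨?_, hat⟩
  rw [sdp0Bound, ← iInf_lpBoundAt_odd]
  exact iInf_congr fun m => iInf_congr (hat m)

theorem theorem4p2 (Φ : ℕ → Polynomial ℝ) (τ₀ a b : ℝ)
    (hdeg : ∀ k : ℕ, (Φ k).degree = (k : WithBot ℕ))
    (hnorm : ∀ k : ℕ, (Φ k).eval τ₀ = 1)
    (hab : a ≤ b) :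
    DelsarteSDP.sdp0Bound Φ a b = DelsarteSDP.lpBound Φ a b ∧
      ∀ m : ℕ, 1 ≤ m →
        DelsarteSDP.sdp0BoundAt Φ a b m = DelsarteSDP.lpBoundAt Φ a b (2 * m - 1) :=
  theorem4p2_general Φ a b (fun k => natDegree_le_of_degree_le (hdeg k).le) hab
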